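/- Let $k=\mathbb F_q$ be a finite field of characteristic $p$, let $m\ge 2$ and $r\ge 1$ be integers and $\lambda$ an integer, with $\gcd(p,m)=1$ and $\gcd(m,r\lambda)=1$, and let $\alpha_1,\dots,\alpha_r\in k$ be pairwise distinct. Let $F=k(x,y)$, where $x$ is transcendental over $k$ and $$y^m=f(x)^\lambda=\prod_{i=1}^r (x-\alpha_i)^\lambda .$$ Let $P_\mu$ be the place of $F$ that is the zero of $x-\alpha_\mu$ $(1\le\mu\le r)$ and $P_\infty$ the place of $F$ that is the pole of $x$ (these places are totally ramified over $k(x)$, hence unique). For a divisor $D$ of $F$ let $\mathcal L(D)=\{h\in F^\times \mid (h)+D\ge 0\}\cup\{0\}$ be its Riemann–Roch space over $k$. Let $A,B,a,b$ be integers with $A\lambda+Bm=1$ and $ar+bm=1$, and put $$z=y^Af(x)^B,\qquad \beta=z^{-a}(x-\alpha_1)^{-b},\qquad h_\mu=\frac{x-\alpha_\mu}{x-\alpha_1}\ (2\le\mu\le r),$$ $$\Lambda_{u,v_2,\dots,v_r}=\beta^u\prod_{\mu=2}^r h_\mu^{v_\mu}\qquad (u,v_2,\dots,v_r\in\mathbb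 Z).$$ For $s_1,\dots,s_r,t\in\mathbb Z$ let $G=\sum_{\mu=1}^r s_\mu P_\mu+tP_\infty$, let $\Theta_{s_1,\dots,s_r,t}$ be the set of all $(u,v_2,\dots,v_r)\in\mathbb Z^r$ such that $$-(a+bm)u-m(v_2+\cdots+v_r)+s_1\ge 0,\qquad 0\le -au+mv_\mu+s_\mu<m\ (2\le\mu\le r),\qquad u\ge -t,$$ and let $\Omega_{s_1,\dots,s_r,t}$ be the set of all $(i,j_2,\dots,j_r)\in\mathbb Z^r$ such that $$i+s_1\ge 0,\qquad 0\le i+mj_\mu+s_\mu<m\ (2\le\mu\le r),\qquad ri+m(j_2+\cdots+j_r)\le t .$$ Then the elements $\Lambda_{u,v_2,\dots,v_r}$ with $(u,v_2,\dots,v_r)\in\Theta_{s_1,\dots,s_r,t}$ form a $k$-basis of $\mathcal L(G)$. Moreover, $\Theta_{s_1,\dots,s_r,t}$ and $\Omega_{s_1,\dots,s_r,t}$ are finite and $\#\Theta_{s_1,\dots,s_r,t}=\#\Omega_{s_1,\dots,s_r,t}$. -/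

import Mathlib

open scoped WithZero

noncomputable section

/-- A place of a field `F` over the constant field `k`, given by its normalized discrete valuation:
a valuation of `F` onto `ℤ ∪ {∞}` (written multiplicatively, as `ℤᵐ⁰`) that is trivial on `k`. -/
structure Place (k F : Type*) [Field k] [Field F] [Algebra k F] where
  /-- The multiplicatively written normalized valuation. -/
  val : Valuation F ℤᵐ⁰
  surjective_val : Function.Surjective val
  val_algebraMap : ∀ c : k, c ≠ 0 → val (algebraMap k F c) = 1

namespace Place

variable {k F : Type*} [Field k] [Field F] [Algebra k F]

/-- The additive valuation `v_P(f)` of `f ≠ 0` (with the irrelevant value `0` at `f = 0`).  The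
multiplicative valuation is `exp (-v_P(f))`, hence the sign. -/
def ord (P : Place k F) (f : F) : ℤ := -WithZero.log (P.val f)

theorem val_le_exp_iff (P : Place k F) {f : F} (hf : f ≠ 0) (d : ℤ) :
    P.val f ≤ WithZero.exp d ↔ 0 ≤ P.ord f + d := by
  have h : P.val f ≠ 0 := (Valuation.ne_zero_iff _).2 hf
  rw [← WithZero.log_le_iff_le_exp h, ord]
  constructor <;> intro h <;> linarith

end Place

/-- Divisors: the free abelian group on the places. -/
abbrev PlaceDivisor (k F : Type*) [Field k] [Field F] [Algebra k F] := Place k F →₀ ℤ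

section

variable {k F : Type*} [Field k] [Field F] [Algebra k F]

theorem riemannRoch_iff (D : PlaceDivisor k F) (f : F) :
    (f = 0 ∨ ∀ P : Place k F, 0 ≤ P.ord f + D P) ↔
      ∀ P : Place k F, P.val f ≤ WithZero.exp (D P) := by
  rcases eq_or_ne f 0 with rfl | hf
  · simp
  · simp [hf, Place.val_le_exp_iff _ hf]

/-- The Riemann–Roch space `L(D) = {f | (f) + D ≥ 0} ∪ {0}`. -/
def riemannRochSpace (D : PlaceDivisor k F) : Submodule k F where
  carrier := {f | f = 0 ∨ ∀ P : Place k F, 0 ≤ P.ord f + D P}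
  zero_mem' := Or.inl rfl
  add_mem' := by
    intro f g hf hg
    rw [Set.mem_ofPred_eq, riemannRoch_iff] at *
    exact fun P => P.val.map_add_le (hf P) (hg P)
  smul_mem' := by
    intro c f hf
    rw [Set.mem_ofPred_eq, riemannRoch_iff] at *
    intro P
    rcases eq_or_ne c 0 with rfl | hc
    · simp
    · rw [Algebra.smul_def, map_mul, P.val_algebraMap c hc, one_mul]
      exact hf P

end

/-! In the following, `r = n + 1`.  The indices `1, …, r` are the elements of `Fin (n + 1)`: index `1`
is `0 : Fin (n + 1)`, and the indices `2, …, r` are the `μ.succ` for `μ : Fin n`. -/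

section

variable {n : ℕ}

/-- The lattice point set `Ω_{s_1,…,s_r,t}` of points `(i, j_2, …, j_r)`. -/
def latticeOmega (m : ℕ) (s : Fin (n + 1) → ℤ) (t : ℤ) : Set (ℤ × (Fin n → ℤ)) :=
  {w | 0 ≤ w.1 + s 0 ∧
    (∀ μ : Fin n, 0 ≤ w.1 + m * w.2 μ + s μ.succ ∧ w.1 + m * w.2 μ + s μ.succ < m) ∧
    ((n + 1 : ℕ) : ℤ) * w.1 + m * ∑ μ, w.2 μ ≤ t}

/-- The lattice point set `Θ_{s_1,…,s_r,t}` of points `(u, v_2, …, v_r)`. -/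
def latticeTheta (m : ℕ) (a b : ℤ) (s : Fin (n + 1) → ℤ) (t : ℤ) : Set (ℤ × (Fin n → ℤ)) :=
  {w | 0 ≤ -(a + b * m) * w.1 - m * ∑ μ, w.2 μ + s 0 ∧
    (∀ μ : Fin n, 0 ≤ -a * w.1 + m * w.2 μ + s μ.succ ∧ -a * w.1 + m * w.2 μ + s μ.succ < m) ∧
    -t ≤ w.1}

variable {k F : Type*} [Field k] [Field F] [Algebra k F]

/-- `f(x) = ∏_{i=1}^r (x - α_i)`. -/
def kummerF (α : Fin (n + 1) → k) (x : F) : F := ∏ i, (x - algebraMap k F (α i))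

/-- `z = y^A f(x)^B`. -/
def kummerZ (α : Fin (n + 1) → k) (x y : F) (A B : ℤ) : F := y ^ A * kummerF α x ^ B

/-- `h_μ = (x - α_μ) / (x - α_1)`. -/
def kummerH (α : Fin (n + 1) → k) (x : F) (μ : Fin (n + 1)) : F :=
  (x - algebraMap k F (α μ)) / (x - algebraMap k F (α 0))

/-- `β = z^{-a} (x - α_1)^{-b}`. -/
def kummerBeta (α : Fin (n + 1) → k) (x y : F) (A B a b : ℤ) : F :=
  kummerZ α x y A B ^ (-a) * (x - algebraMap k F (α 0)) ^ (-b)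

/-- `Λ_{u,v_2,…,v_r} = β^u ∏_{μ=2}^r h_μ^{v_μ}`. -/
def kummerLambda (α : Fin (n + 1) → k) (x y : F) (A B a b : ℤ) (w : ℤ × (Fin n → ℤ)) : F :=
  kummerBeta α x y A B a b ^ w.1 * ∏ μ : Fin n, kummerH α x μ.succ ^ w.2 μ

/-- The divisor `G = ∑_{μ=1}^r s_μ P_μ + t P_∞`. -/
def kummerDivisor (P : Fin (n + 1) → Place k F) (Pinf : Place k F) (s : Fin (n + 1) → ℤ) (t : ℤ) :
    PlaceDivisor k F :=
  ∑ μ, Finsupp.single (P μ) (s μ) + Finsupp.single Pinf t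

end

end

/-! With `z` as generator, F = k(x, z) and z ^ m = f(x). At P_μ the element z has order 1 and x -
α_μ has order m; at P_∞ they have orders -r and -m. So the divisors of the monomials z ^ i ∏ (x -
α_μ) ^ j_μ (μ ≥ 2) are supported on the P_μ and P_∞. The set Ω lists the monomials in L(G), made
unique by the bounds `< m`, since z ^ m = f(x) allows powers of x - α_1 to be traded away.

The crux is spanning (`mem_span_monomial`). For g in L(G), some f ^ M g is regular wherever x is,
hence integral over k[x]. A trace computation, with m invertible in k, then gives f ^ (M + 1) g = ∑
p_i(x) z ^ i with i < m. Since 1 and -r are prime to m, the nonzero terms have distinct orders at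
every P_μ and at P_∞ (`IsKummerOver.ord_sum`). Nothing cancels there, so each term satisfies the
conditions imposed on g, and `term_mem_span` expands it into monomials of Ω. The same absence of
cancellation yields uniqueness of the places and independence of the z ^ i.

Finally Λ_{u,v} is a monomial rewritten by a linear bijection of ℤ ^ r carrying Θ to Ω. Its order at
P_∞ is u, and u determines the point of Θ, whence linear independence. -/

section

open Polynomial

/-! ### Orders at a place and dominant terms -/

namespace Place

variable {k F : Type*} [Field k] [Field F] [Algebra k F]

theorem val_ne_zero (Q : Place k F) {f : F} (hf : f ≠ 0) : Q.val f ≠ 0 :=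
  (Valuation.ne_zero_iff _).2 hf

theorem val_eq_exp (Q : Place k F) {f : F} (hf : f ≠ 0) : Q.val f = WithZero.exp (-Q.ord f) := by
  rw [ord, neg_neg, WithZero.exp_log (Q.val_ne_zero hf)]

theorem val_le_iff_ord_le (Q : Place k F) {f g : F} (hf : f ≠ 0) (hg : g ≠ 0) :
    Q.val f ≤ Q.val g ↔ Q.ord g ≤ Q.ord f := by
  rw [Q.val_eq_exp hf, Q.val_eq_exp hg, WithZero.exp_le_exp, neg_le_neg_iff]

@[simp] theorem ord_zero (Q : Place k F) : Q.ord 0 = 0 := by simp [ord]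

@[simp] theorem ord_one (Q : Place k F) : Q.ord 1 = 0 := by simp [ord]

theorem ord_mul (Q : Place k F) {f g : F} (hf : f ≠ 0) (hg : g ≠ 0) :
    Q.ord (f * g) = Q.ord f + Q.ord g := by
  rw [ord, map_mul, WithZero.log_mul (Q.val_ne_zero hf) (Q.val_ne_zero hg), ord, ord]
  ring

theorem ord_zpow (Q : Place k F) (f : F) (d : ℤ) : Q.ord (f ^ d) = d * Q.ord f := by
  rw [ord, map_zpow₀, WithZero.log_zpow, ord, smul_eq_mul]
  ring

theorem ord_pow (Q : Place k F) (f : F) (d : ℕ) : Q.ord (f ^ d) = d * Q.ord f := by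
  simpa using Q.ord_zpow f d

theorem ord_prod (Q : Place k F) {ι : Type*} (S : Finset ι) (f : ι → F) (hf : ∀ i ∈ S, f i ≠ 0) :
    Q.ord (∏ i ∈ S, f i) = ∑ i ∈ S, Q.ord (f i) := by
  classical
  induction S using Finset.induction_on with
  | empty => simp
  | insert i S hi ih =>
    rw [Finset.prod_insert hi, Finset.sum_insert hi, ord_mul, ih]
    · exact fun j hj => hf j (Finset.mem_insert_of_mem hj)
    · exact hf i (Finset.mem_insert_self _ _)
    · exact Finset.prod_ne_zero_iff.2 fun j hj => hf j (Finset.mem_insert_of_mem hj)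

theorem ord_algebraMap (Q : Place k F) (c : k) : Q.ord (algebraMap k F c) = 0 := by
  rcases eq_or_ne c 0 with rfl | hc
  · simp
  · simp [ord, Q.val_algebraMap c hc]

theorem val_algebraMap_le_one (Q : Place k F) (c : k) : Q.val (algebraMap k F c) ≤ 1 := by
  rcases eq_or_ne c 0 with rfl | hc
  · simp
  · rw [Q.val_algebraMap c hc]

theorem val_le_one_iff (Q : Place k F) {f : F} : Q.val f ≤ 1 ↔ 0 ≤ Q.ord f := by
  rcases eq_or_ne f 0 with rfl | hf
  · simp
  · simpa using Q.val_le_exp_iff hf 0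

/-- Two places with the same order function are equal. -/
theorem eq_of_ord_eq {Q R : Place k F} (h : ∀ g : F, g ≠ 0 → Q.ord g = R.ord g) : Q = R := by
  have hval : Q.val = R.val := by
    ext g
    rcases eq_or_ne g 0 with rfl | hg
    · simp
    · rw [Q.val_eq_exp hg, R.val_eq_exp hg, h g hg]
  cases Q
  cases R
  simpa using hval

theorem exists_ord_eq_one (Q : Place k F) : ∃ g : F, g ≠ 0 ∧ Q.ord g = 1 := by
  obtain ⟨g, hg⟩ := Q.surjective_val (WithZero.exp (-1))
  have hg0 : g ≠ 0 := by
    rintro rfl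
    exact WithZero.exp_ne_zero (hg.symm.trans (map_zero _))
  exact ⟨g, hg0, by rw [ord, hg, WithZero.log_exp, neg_neg]⟩

/-- A finite sum of elements of pairwise distinct orders has the order of its dominant term. -/
theorem ord_sum_of_injOn (Q : Place k F) {ι : Type*} (S : Finset ι) (f : ι → F)
    (hf : ∀ i ∈ S, f i ≠ 0) (hinj : Set.InjOn (fun i => Q.ord (f i)) S) {i₀ : ι} (hi₀ : i₀ ∈ S)
    (hmin : ∀ i ∈ S, Q.ord (f i₀) ≤ Q.ord (f i)) :
    ∑ i ∈ S, f i ≠ 0 ∧ Q.ord (∑ i ∈ S, f i) = Q.ord (f i₀) := by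
  classical
  have hv := Q.val_ne_zero (hf i₀ hi₀)
  have hlt : Q.val (∑ i ∈ S.erase i₀, f i) < Q.val (f i₀) := by
    refine Q.val.map_sum_lt hv fun i hi => ?_
    have hiS := Finset.mem_of_mem_erase hi
    rw [← not_le, Q.val_le_iff_ord_le (hf i₀ hi₀) (hf i hiS)]
    exact fun hle => Finset.ne_of_mem_erase hi (hinj hiS hi₀ (le_antisymm hle (hmin i hiS)))
  have hval : Q.val (∑ i ∈ S, f i) = Q.val (f i₀) := by
    rw [← Finset.add_sum_erase S f hi₀]
    exact Valuation.map_add_eq_of_lt_left _ hlt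
  refine ⟨fun h => hv ?_, by rw [ord, ord, hval]⟩
  rw [← hval, h, map_zero]

/-- The order of `p(g)` at a place where `g` has a zero or a pole. -/
theorem ord_aeval_aux (Q : Place k F) {g : F} (hg : Q.ord g ≠ 0) {p : k[X]} {d : ℕ}
    (hd : p.coeff d ≠ 0) (hmin : ∀ i ∈ p.support, d * Q.ord g ≤ i * Q.ord g) :
    Q.ord (aeval g p) = d * Q.ord g := by
  have hg0 : g ≠ 0 := by
    rintro rfl
    simp at hg
  have hord : ∀ i ∈ p.support, Q.ord (algebraMap k F (p.coeff i) * g ^ i) = i * Q.ord g := by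
    intro i hi
    rw [Q.ord_mul _ (pow_ne_zero _ hg0), ord_algebraMap, zero_add, ord_pow]
    simpa using hi
  have hdS : d ∈ p.support := by simpa using hd
  rw [aeval_def, eval₂_eq_sum, Polynomial.sum_def, ← hord d hdS]
  refine (Q.ord_sum_of_injOn p.support _ (fun i hi => ?_) (fun i hi j hj hij => ?_) hdS
    fun i hi => ?_).2
  · have : p.coeff i ≠ 0 := by simpa using hi
    exact mul_ne_zero (by simpa using this) (pow_ne_zero _ hg0)
  · simp only [hord i hi, hord j hj] at hij
    exact_mod_cast mul_right_cancel₀ hg hij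
  · rw [hord d hdS, hord i hi]
    exact hmin i hi

/-- At a pole of x the leading term dominates. -/
theorem ord_aeval_of_neg (Q : Place k F) {x : F} (hx : Q.ord x < 0) {p : k[X]} (hp : p ≠ 0) :
    Q.ord (aeval x p) = p.natDegree * Q.ord x := by
  refine Q.ord_aeval_aux hx.ne (by simpa using hp) fun i hi => ?_
  have : i ≤ p.natDegree := le_natDegree_of_mem_supp i hi
  exact mul_le_mul_of_nonpos_right (by exact_mod_cast this) hx.le

/-- At a zero of x - c the lowest nonzero term of p expanded in powers of x - c dominates, and its
index is the root multiplicity. -/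
theorem ord_aeval_of_pos (Q : Place k F) {x : F} {c : k} (hx : 0 < Q.ord (x - algebraMap k F c))
    {p : k[X]} (hp : p ≠ 0) :
    Q.ord (aeval x p) = p.rootMultiplicity c * Q.ord (x - algebraMap k F c) := by
  have h : aeval x p = aeval (x - algebraMap k F c) (p.comp (X + C c)) := by
    simp [aeval_comp]
  have hp' : p.comp (X + C c) ≠ 0 := by
    rw [← taylor_apply]
    simpa using hp
  rw [h, rootMultiplicity_eq_natTrailingDegree]
  refine Q.ord_aeval_aux hx.ne' (mt trailingCoeff_eq_zero.1 hp') fun i hi => ?_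
  have : natTrailingDegree (p.comp (X + C c)) ≤ i := natTrailingDegree_le_of_mem_supp i hi
  exact mul_le_mul_of_nonneg_right (by exact_mod_cast this) hx.le

/-- The order at `Q` of the elements `p(x) z ^ i` is `e (m φ(p) + ρ i)`: the place `Q` lies, with
ramification index `e m`, over the place of `k(x)` with order function `φ`. -/
structure IsKummerOver (Q : Place k F) (x z : F) (m : ℕ) (φ : k[X] → ℤ) (ρ e : ℤ) : Prop where
  pos : 0 < e
  ord_aeval : ∀ p : k[X], p ≠ 0 → Q.ord (aeval x p) = e * (m * φ p)
  ord_gen : Q.ord z = e * ρ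

/-! ### Orders of sums ∑ p_i(x) z ^ i at ramified places -/

section IsKummerOver

variable {x z : F} {m : ℕ} {φ : k[X] → ℤ} {ρ : ℤ}

theorem exists_min_order (p : Fin m → k[X]) (hp : p ≠ 0) (φ : k[X] → ℤ) (ρ : ℤ) :
    ∃ i₀, p i₀ ≠ 0 ∧ ∀ i, p i ≠ 0 → m * φ (p i₀) + ρ * (i₀ : ℕ) ≤ m * φ (p i) + ρ * (i : ℕ) := by
  classical
  obtain ⟨j, hj⟩ := Function.ne_iff.1 hp
  obtain ⟨i₀, hi₀, hmin⟩ := Finset.exists_min_image (Finset.univ.filter fun i => p i ≠ 0)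
    (fun i => m * φ (p i) + ρ * ((i : ℕ) : ℤ)) ⟨j, by simpa using hj⟩
  exact ⟨i₀, by simpa using hi₀, fun i hi => hmin i (by simpa using hi)⟩

/-- After division by e, the order of p_i(x) z ^ i is ρ i modulo m. As ρ is prime to m and 0 ≤ i <
m, distinct nonzero terms have distinct orders, so no cancellation occurs. -/
theorem IsKummerOver.ord_sum {Q : Place k F} {e : ℤ} (h : Q.IsKummerOver x z m φ ρ e)
    (hx : Transcendental k x) (hz : z ≠ 0) (hρ : IsCoprime (m : ℤ) ρ) (p : Fin m → k[X])
    {i₀ : Fin m} (hi₀ : p i₀ ≠ 0)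
    (hmin : ∀ i, p i ≠ 0 → m * φ (p i₀) + ρ * (i₀ : ℕ) ≤ m * φ (p i) + ρ * (i : ℕ)) :
    ∑ i, aeval x (p i) * z ^ (i : ℕ) ≠ 0 ∧
      Q.ord (∑ i, aeval x (p i) * z ^ (i : ℕ)) = e * (m * φ (p i₀) + ρ * (i₀ : ℕ)) := by
  classical
  have hne : ∀ {q : k[X]}, q ≠ 0 → aeval x q ≠ 0 := fun hq h0 => hq <| by
    by_contra hq
    exact hx ⟨_, hq, h0⟩
  have hord : ∀ i, p i ≠ 0 →
      Q.ord (aeval x (p i) * z ^ (i : ℕ)) = e * (m * φ (p i) + ρ * (i : ℕ)) := by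
    intro i hi
    rw [Q.ord_mul (hne hi) (pow_ne_zero _ hz), h.ord_aeval _ hi, ord_pow, h.ord_gen]
    ring
  have hsum : ∑ i, aeval x (p i) * z ^ (i : ℕ) =
      ∑ i with p i ≠ 0, aeval x (p i) * z ^ (i : ℕ) := by
    rw [Finset.sum_filter]
    refine Finset.sum_congr rfl fun i _ => ?_
    split_ifs with hi
    · rfl
    · rw [not_not.1 hi, map_zero, zero_mul]
  rw [hsum, ← hord i₀ hi₀]
  refine Q.ord_sum_of_injOn _ _ (fun i hi => ?_) (fun i hi j hj hij => ?_) (by simpa using hi₀)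
    fun i hi => ?_
  · exact mul_ne_zero (hne (by simpa using hi)) (pow_ne_zero _ hz)
  · simp only [hord i (by simpa using hi), hord j (by simpa using hj)] at hij
    have h1 := mul_left_cancel₀ h.pos.ne' hij
    have h2 : (m : ℤ) ∣ ρ * ((i : ℕ) - (j : ℕ)) := ⟨φ (p j) - φ (p i), by linear_combination h1⟩
    have h3 : (m : ℤ) ∣ ((i : ℕ) - (j : ℕ)) := hρ.dvd_of_dvd_mul_left h2
    have h4 := Int.eq_zero_of_abs_lt_dvd h3 (by rw [abs_lt]; constructor <;> omega)
    ext
    omega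
  · have hi' : p i ≠ 0 := by simpa using hi
    rw [hord i₀ hi₀, hord i hi']
    exact mul_le_mul_of_nonneg_left (hmin i hi') h.pos.le

/-- Independence of the powers of z over k[x] comes from a single ramified place; irreducibility of
the polynomial T ^ m - f(x) is not needed. -/
theorem IsKummerOver.sum_ne_zero {Q : Place k F} {e : ℤ} (h : Q.IsKummerOver x z m φ ρ e)
    (hx : Transcendental k x) (hz : z ≠ 0) (hρ : IsCoprime (m : ℤ) ρ) {p : Fin m → k[X]}
    (hp : p ≠ 0) : ∑ i, aeval x (p i) * z ^ (i : ℕ) ≠ 0 := by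
  obtain ⟨i₀, hi₀, hmin⟩ := exists_min_order p hp φ ρ
  exact (h.ord_sum hx hz hρ p hi₀ hmin).1

/-- The integer N is read off from one representation of g using only φ and ρ, so it serves all
places of this type at once. -/
theorem IsKummerOver.exists_ord_eq (hx : Transcendental k x) (hz : z ≠ 0)
    (hρ : IsCoprime (m : ℤ) ρ)
    (hrep : ∀ g : F, ∃ d : k[X], d ≠ 0 ∧ ∃ p : Fin m → k[X],
      aeval x d * g = ∑ i, aeval x (p i) * z ^ (i : ℕ)) {g : F} (hg : g ≠ 0) :
    ∃ N : ℤ, ∀ (Q : Place k F) (e : ℤ), Q.IsKummerOver x z m φ ρ e → Q.ord g = e * N := by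
  obtain ⟨d, hd, p, hdp⟩ := hrep g
  have hd' : aeval x d ≠ 0 := fun h0 => hx ⟨_, hd, h0⟩
  have hp : p ≠ 0 := by
    rintro rfl
    simp [hd', hg] at hdp
  obtain ⟨i₀, hi₀, hmin⟩ := exists_min_order p hp φ ρ
  refine ⟨m * φ (p i₀) + ρ * (i₀ : ℕ) - m * φ d, fun Q e h => ?_⟩
  have h1 := (h.ord_sum hx hz hρ p hi₀ hmin).2
  rw [← hdp, Q.ord_mul hd' hg, h.ord_aeval d hd] at h1
  linear_combination h1

/-- All orders at Q are multiples of e, while a normalized valuation attains 1. -/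
theorem IsKummerOver.eq_one (hx : Transcendental k x) (hz : z ≠ 0) (hρ : IsCoprime (m : ℤ) ρ)
    (hrep : ∀ g : F, ∃ d : k[X], d ≠ 0 ∧ ∃ p : Fin m → k[X],
      aeval x d * g = ∑ i, aeval x (p i) * z ^ (i : ℕ))
    {Q : Place k F} {e : ℤ} (h : Q.IsKummerOver x z m φ ρ e) : e = 1 := by
  obtain ⟨g, hg, hg1⟩ := Q.exists_ord_eq_one
  obtain ⟨N, hN⟩ := IsKummerOver.exists_ord_eq (φ := φ) hx hz hρ hrep hg
  have h1 := hN Q e h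
  exact Int.eq_one_of_mul_eq_one_right h.pos.le (by rw [← h1, hg1])

theorem IsKummerOver.unique (hx : Transcendental k x) (hz : z ≠ 0) (hρ : IsCoprime (m : ℤ) ρ)
    (hrep : ∀ g : F, ∃ d : k[X], d ≠ 0 ∧ ∃ p : Fin m → k[X],
      aeval x d * g = ∑ i, aeval x (p i) * z ^ (i : ℕ))
    {Q R : Place k F} {e e' : ℤ} (h : Q.IsKummerOver x z m φ ρ e)
    (h' : R.IsKummerOver x z m φ ρ e') : Q = R := by
  refine eq_of_ord_eq fun g hg => ?_
  obtain ⟨N, hN⟩ := IsKummerOver.exists_ord_eq (φ := φ) hx hz hρ hrep hg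
  rw [hN Q e h, hN R e' h', h.eq_one hx hz hρ hrep, h'.eq_one hx hz hρ hrep]

end IsKummerOver

end Place

/-! ### Integrality and traces in a simple radical extension -/

section AlgebraicCore

variable {k F : Type*} [Field k] [Field F]

/-- The place attached to a maximal ideal of a Dedekind domain with fraction field `F`. -/
noncomputable def IsDedekindDomain.HeightOneSpectrum.place (k : Type*) {F C : Type*} [Field k] [Field F]
    [Algebra k F] [CommRing C] [IsDedekindDomain C] [Algebra C F] [IsFractionRing C F]
    [Algebra k C] [IsScalarTower k C F] (v : HeightOneSpectrum C) : Place k F where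
  val := v.valuation F
  surjective_val := v.valuation_surjective F
  val_algebraMap c hc := by
    have h : ∀ c : k, v.valuation F (algebraMap k F c) ≤ 1 := fun c => by
      rw [IsScalarTower.algebraMap_apply k C F]
      exact v.valuation_le_one _
    refine le_antisymm (h c) ?_
    have h1 := h c⁻¹
    have hne : v.valuation F (algebraMap k F c) ≠ 0 := by simpa using hc
    rwa [map_inv₀, map_inv₀, inv_le_one₀ (zero_lt_iff.2 hne)] at h1

variable {K : Type*} [Field K] [Algebra K F]

/-- The powers `z ^ i`, `i < m`, span a simple radical extension. -/
theorem exists_sum_pow_of_pow_eq {m : ℕ} (hm : 0 < m) {z : F} {a : K}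
    (hz : z ^ m = algebraMap K F a) (htop : IntermediateField.adjoin K {z} = ⊤) (g : F) :
    ∃ c : Fin m → K, g = ∑ i, c i • z ^ (i : ℕ) := by
  have hmonic : (X ^ m - C a : K[X]).Monic := monic_X_pow_sub_C a hm.ne'
  have hroot : aeval z (X ^ m - C a : K[X]) = 0 := by simp [hz]
  have hint : IsIntegral K z := ⟨_, hmonic, hroot⟩
  have hg : g ∈ Algebra.adjoin K {z} := by
    rw [← IntermediateField.adjoin_simple_toSubalgebra_of_isAlgebraic hint.isAlgebraic, htop]
    trivial
  rw [Algebra.adjoin_singleton_eq_range_aeval] at hg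
  obtain ⟨q, rfl⟩ := hg
  refine ⟨fun i => (q %ₘ (X ^ m - C a)).coeff i, ?_⟩
  have hdeg : (q %ₘ (X ^ m - C a)).natDegree < m := by
    have := natDegree_modByMonic_lt q hmonic (fun h => by
      have := congrArg natDegree h
      rw [natDegree_X_pow_sub_C, natDegree_one] at this
      omega)
    rwa [natDegree_X_pow_sub_C] at this
  change aeval z q = _
  rw [← aeval_modByMonic_eq_self_of_root hroot, aeval_eq_sum_range' hdeg,
    Finset.sum_range]

/-- Powers of the radical `z` of exponent not divisible by `m` have trace zero. -/
theorem trace_pow_eq_zero {m : ℕ} {z : F} {a : K} (hz : z ^ m = algebraMap K F a)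
    (b : Module.Basis (Fin m) K F) (hb : ∀ i, b i = z ^ (i : ℕ)) {j : ℕ} (hj : ¬ m ∣ j) :
    Algebra.trace K F (z ^ j) = 0 := by
  rw [Algebra.trace_eq_matrix_trace b, Matrix.trace]
  refine Finset.sum_eq_zero fun i _ => ?_
  have hm : 0 < m := i.pos
  -- Multiplication by z ^ j permutes the basis cyclically up to scalars, so a nonzero diagonal
  -- entry would force m ∣ j.
  have h : z ^ j * b i = a ^ ((j + i) / m) • b ⟨(j + i) % m, Nat.mod_lt _ hm⟩ := by
    rw [hb, hb, ← pow_add, Algebra.smul_def, map_pow, ← hz, ← pow_mul, ← pow_add, Nat.div_add_mod]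
  rw [Matrix.diag_apply, Algebra.leftMulMatrix_eq_repr_mul, h, map_smul, Finsupp.smul_apply,
    Module.Basis.repr_self, Finsupp.single_eq_of_ne, smul_zero]
  intro hi
  have h1 : (i : ℕ) = (j + i) % m := congrArg Fin.val hi
  have h2 : j + i ≡ 0 + i [MOD m] := by
    rw [Nat.ModEq, ← h1, zero_add, Nat.mod_eq_of_lt i.2]
  exact hj ((Nat.modEq_zero_iff_dvd).1 (Nat.ModEq.add_right_cancel' _ h2))

variable [Algebra k[X] F] [Algebra k[X] K] [IsFractionRing k[X] K] [IsScalarTower k[X] K F]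

/-- An element that is regular at all places where `x` is regular is integral over `k[x]`. -/
theorem isIntegral_of_forall_place [Algebra k F] [IsScalarTower k k[X] F] [FiniteDimensional K F] [Algebra.IsSeparable K F] {g : F}
    (hg : ∀ Q : Place k F, Q.val (algebraMap k[X] F X) ≤ 1 → Q.val g ≤ 1) :
    IsIntegral k[X] g := by
  have := integralClosure.isDedekindDomain k[X] K F
  have := integralClosure.isFractionRing_of_finite_extension (A := k[X]) K F
  have h : g ∈ (algebraMap (integralClosure k[X] F) F).range := by
    refine IsDedekindDomain.HeightOneSpectrum.mem_integers_of_valuation_le_one F g fun v => ?_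
    have : IsScalarTower k (integralClosure k[X] F) F := inferInstance
    -- The element x lies in the integral closure, so it is regular at every maximal ideal and the
    -- hypothesis on g applies there.
    refine hg (v.place k) ?_
    exact v.valuation_le_one (K := F) (algebraMap k[X] (integralClosure k[X] F) X)
  obtain ⟨c, rfl⟩ := h
  exact c.2

/-- The coefficients of an integral element with respect to the powers of the radical `z`. -/
theorem exists_poly_of_isIntegral {m : ℕ} (hmk : (m : k) ≠ 0) {z : F} {f : k[X]}
    (hz : z ^ m = algebraMap k[X] F f)
    (b : Module.Basis (Fin m) K F) (hb : ∀ i, b i = z ^ (i : ℕ)) {g : F} (hg : IsIntegral k[X] g) :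
    ∃ p : Fin m → k[X],
      algebraMap k[X] F f * g = ∑ i, algebraMap k[X] F (p i) * z ^ (i : ℕ) := by
  have : FiniteDimensional K F := Module.Finite.of_basis b
  have hzK : z ^ m = algebraMap K F (algebraMap k[X] K f) := by
    rw [hz, IsScalarTower.algebraMap_apply k[X] K F]
  have hm : 0 < m := Nat.pos_of_ne_zero fun h => hmk (by simp [h])
  have hzint : IsIntegral k[X] z := IsIntegral.of_pow hm (hz ▸ isIntegral_algebraMap)
  -- The trace isolates the i-th coefficient: the exponents j + m - i lie strictly between 0 and 2m,
  -- so only j = i gives a multiple of m.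
  have htr : ∀ i : Fin m, Algebra.trace K F (g * z ^ (m - (i : ℕ))) =
      m * (b.repr g i * algebraMap k[X] K f) := by
    intro i
    conv_lhs => rw [← b.sum_repr g, Finset.sum_mul, map_sum]
    rw [Finset.sum_eq_single i]
    · have h1 : (b.repr g i • b i) * z ^ (m - (i : ℕ)) =
          algebraMap K F (b.repr g i * algebraMap k[X] K f) := by
        rw [hb, smul_mul_assoc, ← pow_add, Nat.add_sub_cancel' i.2.le, hzK, Algebra.smul_def,
          map_mul]
      rw [h1, Algebra.trace_algebraMap, Module.finrank_eq_card_basis b, Fintype.card_fin,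
        nsmul_eq_mul]
    · intro j _ hji
      rw [hb, smul_mul_assoc, map_smul, ← pow_add, trace_pow_eq_zero hzK b hb, smul_zero]
      intro hdvd
      apply hji
      ext
      obtain ⟨c, hc⟩ := hdvd
      have hi := i.2
      have hj := j.2
      have hc1 : c = 1 := by
        have h1 : m * c < m * 2 := by omega
        have h2 : 0 < m * c := by omega
        have h3 : c < 2 := lt_of_mul_lt_mul_left' h1
        have h4 : 0 < c := Nat.pos_of_mul_pos_left h2
        omega
      subst hc1
      omega
    · simp
  have hex : ∀ i : Fin m, ∃ p : k[X], algebraMap k[X] K p = b.repr g i * algebraMap k[X] K f := by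
    intro i
    have hint : IsIntegral k[X] (Algebra.trace K F (g * z ^ (m - (i : ℕ)))) :=
      Algebra.isIntegral_trace (hg.mul (hzint.pow _))
    obtain ⟨q, hq⟩ := IsIntegrallyClosed.isIntegral_iff.1 hint
    -- The trace is integral and lies in k(x), so it is a polynomial q; dividing by the unit m
    -- leaves the coefficient times f. This is the source of the factor f in the conclusion.
    refine ⟨C ((m : k)⁻¹) * q, ?_⟩
    have hmm : algebraMap k[X] K (C ((m : k)⁻¹)) * (m : K) = 1 := by
      rw [← map_natCast (algebraMap k[X] K), ← map_mul, ← C_eq_natCast, ← C_mul,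
        inv_mul_cancel₀ hmk, C_1, map_one]
    rw [map_mul, hq, htr, ← mul_assoc, hmm, one_mul]
  choose p hp using hex
  refine ⟨p, ?_⟩
  conv_lhs => rw [← b.sum_repr g, Finset.mul_sum]
  refine Finset.sum_congr rfl fun i _ => ?_
  rw [hb, IsScalarTower.algebraMap_apply k[X] K F, IsScalarTower.algebraMap_apply k[X] K F (p i),
    hp, map_mul, Algebra.smul_def]
  ring

end AlgebraicCore

/-! ### Representations ∑ p_i(x) z ^ i in k(x, z) -/

section KummerExtension

variable {k F : Type*} [Field k] [Field F] [Algebra k F] {x z : F} {m : ℕ} {f : k[X]}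

theorem adjoin_radical_eq_top {K : Type*} [Field K] [Algebra k K] [Algebra K F]
    [IsScalarTower k K F] (hxK : x ∈ (algebraMap K F).range)
    (htop : IntermediateField.adjoin k {x, z} = ⊤) : IntermediateField.adjoin K {z} = ⊤ := by
  have h : IntermediateField.adjoin k {x, z} ≤
      (IntermediateField.adjoin K {z}).restrictScalars k := by
    rw [IntermediateField.adjoin_le_iff]
    rintro g (rfl | rfl)
    · obtain ⟨c, rfl⟩ := hxK
      exact (IntermediateField.adjoin K {z}).algebraMap_mem c
    · exact IntermediateField.mem_adjoin_simple_self K _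
  rw [eq_top_iff]
  intro g _
  have hg : g ∈ IntermediateField.adjoin k {x, z} := by
    rw [htop]
    trivial
  exact h hg

/-- In `F = k(x, z)` with `z ^ m = f(x)`, every element has a multiple by a polynomial in `x` of
the form `∑ p_i(x) z ^ i`. -/
theorem exists_mul_eq_sum (hx : Transcendental k x) (hm : 0 < m) (hz : z ^ m = aeval x f)
    (htop : IntermediateField.adjoin k {x, z} = ⊤) (g : F) :
    ∃ d : k[X], d ≠ 0 ∧ ∃ p : Fin m → k[X],
      aeval x d * g = ∑ i, aeval x (p i) * z ^ (i : ℕ) := by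
  -- F becomes a k[X]-algebra through X ↦ x; transcendence of x makes it faithful, so that F is an
  -- extension of the fraction field.
  let : Algebra k[X] F := (aeval x).toAlgebra
  have : IsScalarTower k k[X] F := IsScalarTower.of_algHom (aeval x)
  have : FaithfulSMul k[X] F :=
    (faithfulSMul_iff_algebraMap_injective _ _).2 (transcendental_iff_injective.1 hx)
  let := FractionRing.liftAlgebra k[X] F
  have := FractionRing.isScalarTower_liftAlgebra k[X] F
  have : IsScalarTower k (FractionRing k[X]) F := IsScalarTower.of_algebraMap_eq fun c => by
    rw [IsScalarTower.algebraMap_apply k k[X] F,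
      IsScalarTower.algebraMap_apply k[X] (FractionRing k[X]) F,
      ← IsScalarTower.algebraMap_apply k k[X] (FractionRing k[X])]
  have hmap : ∀ q : k[X], algebraMap k[X] F q = aeval x q := fun _ => rfl
  have htopK := adjoin_radical_eq_top (K := FractionRing k[X]) (z := z)
    ⟨algebraMap k[X] _ X, by rw [← IsScalarTower.algebraMap_apply, hmap, aeval_X]⟩ htop
  obtain ⟨c, hc⟩ := exists_sum_pow_of_pow_eq (K := FractionRing k[X])
    (a := algebraMap k[X] _ f) hm (by rw [hz, ← IsScalarTower.algebraMap_apply, hmap]) htopK g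
  obtain ⟨d, hd⟩ := IsLocalization.exist_integer_multiples_of_finite (nonZeroDivisors k[X]) c
  choose p hp using hd
  refine ⟨d, nonZeroDivisors.ne_zero d.2, p, ?_⟩
  rw [hc, Finset.mul_sum]
  refine Finset.sum_congr rfl fun i _ => ?_
  rw [← hmap, ← hmap, IsScalarTower.algebraMap_apply k[X] (FractionRing k[X]) F (p i), hp,
    Algebra.smul_def, Algebra.smul_def, map_mul, ← IsScalarTower.algebraMap_apply, mul_assoc]

/-- In `F = k(x, z)` with `z ^ m = f(x)` and `m` prime to the characteristic, an element `g` that is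
regular at all places where `x` is regular satisfies `f(x) g = ∑ p_i(x) z ^ i`. -/
theorem exists_mul_eq_sum_of_forall_place (hx : Transcendental k x) (hmk : (m : k) ≠ 0)
    (hf : f ≠ 0) (hz : z ^ m = aeval x f) (htop : IntermediateField.adjoin k {x, z} = ⊤)
    (hli : ∀ p : Fin m → k[X], p ≠ 0 → ∑ i, aeval x (p i) * z ^ (i : ℕ) ≠ 0) {g : F}
    (hg : ∀ Q : Place k F, Q.val x ≤ 1 → Q.val g ≤ 1) :
    ∃ p : Fin m → k[X], aeval x f * g = ∑ i, aeval x (p i) * z ^ (i : ℕ) := by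
  have hm : 0 < m := Nat.pos_of_ne_zero fun h => hmk (by simp [h])
  let : Algebra k[X] F := (aeval x).toAlgebra
  have : IsScalarTower k k[X] F := IsScalarTower.of_algHom (aeval x)
  have : FaithfulSMul k[X] F :=
    (faithfulSMul_iff_algebraMap_injective _ _).2 (transcendental_iff_injective.1 hx)
  let := FractionRing.liftAlgebra k[X] F
  have := FractionRing.isScalarTower_liftAlgebra k[X] F
  have : IsScalarTower k (FractionRing k[X]) F := IsScalarTower.of_algebraMap_eq fun c => by
    rw [IsScalarTower.algebraMap_apply k k[X] F,
      IsScalarTower.algebraMap_apply k[X] (FractionRing k[X]) F,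
      ← IsScalarTower.algebraMap_apply k k[X] (FractionRing k[X])]
  have hmap : ∀ q : k[X], algebraMap k[X] F q = aeval x q := fun _ => rfl
  have htopK := adjoin_radical_eq_top (K := FractionRing k[X]) (z := z)
    ⟨algebraMap k[X] _ X, by rw [← IsScalarTower.algebraMap_apply, hmap, aeval_X]⟩ htop
  have hzK : z ^ m = algebraMap (FractionRing k[X]) F (algebraMap k[X] _ f) := by
    rw [hz, ← IsScalarTower.algebraMap_apply, hmap]
  have hLI : LinearIndependent (FractionRing k[X]) fun i : Fin m => z ^ (i : ℕ) := by
    rw [← LinearIndependent.iff_fractionRing k[X], Fintype.linearIndependent_iff]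
    intro p hp
    by_contra! hne
    refine hli p (fun h0 => ?_) (by simpa only [Algebra.smul_def, hmap] using hp)
    obtain ⟨i, hi⟩ := hne
    exact hi (congrFun h0 i)
  let b : Module.Basis (Fin m) (FractionRing k[X]) F := Module.Basis.mk hLI <| by
    intro g _
    obtain ⟨c, rfl⟩ := exists_sum_pow_of_pow_eq hm hzK htopK g
    exact Submodule.sum_mem _ fun i _ => Submodule.smul_mem _ _ (Submodule.subset_span ⟨i, rfl⟩)
  have hb : ∀ i, b i = z ^ (i : ℕ) := fun i => Module.Basis.mk_apply _ _ i
  have : FiniteDimensional (FractionRing k[X]) F := Module.Finite.of_basis b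
  have hsep : IsSeparable (FractionRing k[X]) z := by
    have hmK : ((m : ℕ) : FractionRing k[X]) ≠ 0 := by
      rw [← map_natCast (algebraMap k (FractionRing k[X]))]
      exact (_root_.map_ne_zero _).2 hmk
    refine (separable_X_pow_sub_C (algebraMap k[X] (FractionRing k[X]) f) hmK
      (by simpa using hf)).of_dvd (minpoly.dvd _ _ ?_)
    simp [hzK]
  have : Algebra.IsSeparable (FractionRing k[X]) F := by
    have h1 := (IntermediateField.isSeparable_adjoin_simple_iff_isSeparable _ _).2 hsep
    rw [htopK] at h1
    exact Algebra.IsSeparable.of_algHom _ _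
      (IntermediateField.topEquiv (F := FractionRing k[X]) (E := F)).symm.toAlgHom
  have hint : IsIntegral k[X] g := isIntegral_of_forall_place (K := FractionRing k[X])
    (by simpa only [hmap, aeval_X] using hg)
  exact exists_poly_of_isIntegral hmk hz b hb hint

end KummerExtension

/-! ### Monomials, their orders, and the places P_μ and P_∞ -/

section KummerMonomial

variable {k F : Type*} [Field k] [Field F] [Algebra k F] {n : ℕ}

/-- The monomial `z ^ i ∏_{μ ≥ 2} (x - α_μ) ^ j_μ`. -/
def kummerMonomial (α : Fin (n + 1) → k) (x z : F) (w : ℤ × (Fin n → ℤ)) : F :=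
  z ^ w.1 * ∏ μ : Fin n, (x - algebraMap k F (α μ.succ)) ^ w.2 μ

/-- The polynomial `∏ (X - α_i)`. -/
noncomputable def kummerPoly (α : Fin (n + 1) → k) : k[X] := ∏ i, (X - C (α i))

theorem monic_kummerPoly (α : Fin (n + 1) → k) : (kummerPoly α).Monic :=
  monic_prod_of_monic _ _ fun i _ => monic_X_sub_C (α i)

theorem natDegree_kummerPoly (α : Fin (n + 1) → k) : (kummerPoly α).natDegree = n + 1 := by
  rw [kummerPoly, natDegree_prod_of_monic _ _ fun i _ => monic_X_sub_C (α i)]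
  simp

theorem aeval_kummerPoly (α : Fin (n + 1) → k) (x : F) :
    aeval x (kummerPoly α) = kummerF α x := by
  simp [kummerPoly, kummerF, map_prod]

theorem rootMultiplicity_kummerPoly {α : Fin (n + 1) → k} (hα : Function.Injective α)
    (μ : Fin (n + 1)) : (kummerPoly α).rootMultiplicity (α μ) = 1 := by
  classical
  have h : (kummerPoly α).roots = Finset.univ.val.map α := by
    rw [kummerPoly, Finset.prod_eq_multiset_prod,
      ← roots_multiset_prod_X_sub_C (Finset.univ.val.map α), Multiset.map_map]
    rfl
  rw [← count_roots, h, Multiset.count_map_eq_count' _ _ hα]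
  exact Multiset.count_eq_one_of_mem Finset.univ.nodup (Finset.mem_univ μ)

/-- `F = k(x, z)` with `z ^ m = ∏ (x - α_i)`, where the `n + 1` elements `α_i` are distinct, `m` is
prime to `n + 1` and nonzero in `k`. -/
structure IsKummerGenerator (α : Fin (n + 1) → k) (x z : F) (m : ℕ) : Prop where
  injective : Function.Injective α
  transcendental : Transcendental k x
  natCast_ne_zero : (m : k) ≠ 0
  isCoprime : IsCoprime (m : ℤ) ((n + 1 : ℕ) : ℤ)
  pow_eq : z ^ m = kummerF α x
  adjoin_eq_top : IntermediateField.adjoin k {x, z} = ⊤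

namespace IsKummerGenerator

variable {α : Fin (n + 1) → k} {x z : F} {m : ℕ}

theorem pos (h : IsKummerGenerator α x z m) : 0 < m :=
  Nat.pos_of_ne_zero fun h0 => h.natCast_ne_zero (by simp [h0])

theorem aeval_ne_zero (h : IsKummerGenerator α x z m) {p : k[X]} (hp : p ≠ 0) : aeval x p ≠ 0 :=
  fun h0 => h.transcendental ⟨p, hp, h0⟩

theorem sub_ne_zero (h : IsKummerGenerator α x z m) (c : k) : x - algebraMap k F c ≠ 0 := by
  simpa using h.aeval_ne_zero (X_sub_C_ne_zero c)

theorem kummerF_ne_zero (h : IsKummerGenerator α x z m) : kummerF α x ≠ 0 :=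
  Finset.prod_ne_zero_iff.2 fun i _ => h.sub_ne_zero (α i)

theorem ne_zero (h : IsKummerGenerator α x z m) : z ≠ 0 := by
  rintro rfl
  exact h.kummerF_ne_zero (by rw [← h.pow_eq, zero_pow h.pos.ne'])

theorem pow_eq_aeval (h : IsKummerGenerator α x z m) : z ^ m = aeval x (kummerPoly α) := by
  rw [h.pow_eq, aeval_kummerPoly]

theorem ord_kummerF (h : IsKummerGenerator α x z m) (Q : Place k F) :
    Q.ord (kummerF α x) = m * Q.ord z := by
  rw [← h.pow_eq, Q.ord_pow]

theorem monomial_ne_zero (h : IsKummerGenerator α x z m) (w : ℤ × (Fin n → ℤ)) :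
    kummerMonomial α x z w ≠ 0 :=
  mul_ne_zero (zpow_ne_zero _ h.ne_zero)
    (Finset.prod_ne_zero_iff.2 fun _ _ => zpow_ne_zero _ (h.sub_ne_zero _))

theorem ord_monomial (h : IsKummerGenerator α x z m) (Q : Place k F) (w : ℤ × (Fin n → ℤ)) :
    Q.ord (kummerMonomial α x z w) =
      w.1 * Q.ord z + ∑ μ : Fin n, w.2 μ * Q.ord (x - algebraMap k F (α μ.succ)) := by
  have hne : ∀ μ ∈ (Finset.univ : Finset (Fin n)),
      (x - algebraMap k F (α μ.succ)) ^ w.2 μ ≠ 0 := fun μ _ => zpow_ne_zero _ (h.sub_ne_zero _)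
  rw [kummerMonomial, Q.ord_mul (zpow_ne_zero _ h.ne_zero) (Finset.prod_ne_zero_iff.2 hne),
    Q.ord_prod _ _ hne, Q.ord_zpow]
  simp only [Q.ord_zpow]

/-- Trading powers of `x - α_1` for powers of `z ^ m`. -/
theorem monomial_add_mul (h : IsKummerGenerator α x z m) (i c : ℤ) (j : Fin n → ℤ) :
    kummerMonomial α x z (i + m * c, fun μ => j μ - c) =
      z ^ i * (x - algebraMap k F (α 0)) ^ c *
        ∏ μ : Fin n, (x - algebraMap k F (α μ.succ)) ^ j μ := by
  have h1 : z ^ (i + m * c) = z ^ i * ((x - algebraMap k F (α 0)) ^ c *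
      ∏ μ : Fin n, (x - algebraMap k F (α μ.succ)) ^ c) := by
    rw [zpow_add₀ h.ne_zero, zpow_mul, zpow_natCast, h.pow_eq, kummerF, Fin.prod_univ_succ,
      mul_zpow, Finset.prod_zpow]
  have h2 : ∀ μ : Fin n, (x - algebraMap k F (α μ.succ)) ^ j μ =
      (x - algebraMap k F (α μ.succ)) ^ c * (x - algebraMap k F (α μ.succ)) ^ (j μ - c) := by
    intro μ
    rw [← zpow_add₀ (h.sub_ne_zero _)]
    congr 1
    ring
  simp only [kummerMonomial, h1, h2, Finset.prod_mul_distrib]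
  ring

theorem exists_mul_eq_sum (h : IsKummerGenerator α x z m) (g : F) :
    ∃ d : k[X], d ≠ 0 ∧ ∃ p : Fin m → k[X],
      aeval x d * g = ∑ i, aeval x (p i) * z ^ (i : ℕ) :=
  _root_.exists_mul_eq_sum h.transcendental h.pos h.pow_eq_aeval h.adjoin_eq_top g

/-- Since α_μ is a simple root of f, x - α_μ has order m · ord z. All relevant orders are thus
multiples of e = ord z, which `IsKummerOver.eq_one` then shows to be 1. -/
theorem isKummerOver_finite_aux (h : IsKummerGenerator α x z m) {Q : Place k F} {μ : Fin (n + 1)}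
    (hQ : 0 < Q.ord (x - algebraMap k F (α μ))) :
    Q.IsKummerOver x z m (fun p => p.rootMultiplicity (α μ)) 1 (Q.ord z) := by
  have h1 : Q.ord (x - algebraMap k F (α μ)) = m * Q.ord z := by
    rw [← h.ord_kummerF, ← aeval_kummerPoly, Q.ord_aeval_of_pos hQ (monic_kummerPoly α).ne_zero,
      rootMultiplicity_kummerPoly h.injective, Nat.cast_one, one_mul]
  refine ⟨?_, fun p hp => ?_, by ring⟩
  · rw [h1] at hQ
    exact pos_of_mul_pos_right hQ (Nat.cast_nonneg m)
  · rw [Q.ord_aeval_of_pos hQ hp, h1]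
    ring

theorem isKummerOver_finite (h : IsKummerGenerator α x z m) {Q : Place k F} {μ : Fin (n + 1)}
    (hQ : 0 < Q.ord (x - algebraMap k F (α μ))) :
    Q.IsKummerOver x z m (fun p => p.rootMultiplicity (α μ)) 1 1 := by
  have h1 := h.isKummerOver_finite_aux hQ
  rwa [h1.eq_one h.transcendental h.ne_zero isCoprime_one_right h.exists_mul_eq_sum] at h1

/-- From m · ord z = r · ord x and coprimality, m divides ord x; the common factor is e = -(ord x) /
m. -/
theorem isKummerOver_infinity_aux (h : IsKummerGenerator α x z m) {Q : Place k F}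
    (hQ : Q.ord x < 0) :
    ∃ e, Q.IsKummerOver x z m (fun p => -(p.natDegree : ℤ)) (-((n + 1 : ℕ) : ℤ)) e := by
  have h1 : m * Q.ord z = ((n + 1 : ℕ) : ℤ) * Q.ord x := by
    rw [← h.ord_kummerF, ← aeval_kummerPoly, Q.ord_aeval_of_neg hQ (monic_kummerPoly α).ne_zero,
      natDegree_kummerPoly]
  obtain ⟨e, he⟩ : (m : ℤ) ∣ Q.ord x := h.isCoprime.dvd_of_dvd_mul_left ⟨_, h1.symm⟩
  have hm : (0 : ℤ) < m := by exact_mod_cast h.pos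
  refine ⟨-e, ?_, fun p hp => ?_, ?_⟩
  · rw [he] at hQ
    exact neg_pos.2 (neg_of_mul_neg_right hQ hm.le)
  · rw [Q.ord_aeval_of_neg hQ hp, he]
    ring
  · refine mul_left_cancel₀ hm.ne' ?_
    rw [h1, he]
    ring

theorem isKummerOver_infinity (h : IsKummerGenerator α x z m) {Q : Place k F}
    (hQ : Q.ord x < 0) :
    Q.IsKummerOver x z m (fun p => -(p.natDegree : ℤ)) (-((n + 1 : ℕ) : ℤ)) 1 := by
  obtain ⟨e, he⟩ := h.isKummerOver_infinity_aux hQ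
  rwa [he.eq_one h.transcendental h.ne_zero h.isCoprime.neg_right h.exists_mul_eq_sum] at he

theorem eq_of_ord_sub_pos (h : IsKummerGenerator α x z m) {Q R : Place k F} {μ : Fin (n + 1)}
    (hQ : 0 < Q.ord (x - algebraMap k F (α μ))) (hR : 0 < R.ord (x - algebraMap k F (α μ))) :
    Q = R :=
  (h.isKummerOver_finite hQ).unique h.transcendental h.ne_zero isCoprime_one_right
    h.exists_mul_eq_sum (h.isKummerOver_finite hR)

theorem eq_of_ord_neg (h : IsKummerGenerator α x z m) {Q R : Place k F}
    (hQ : Q.ord x < 0) (hR : R.ord x < 0) : Q = R :=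
  (h.isKummerOver_infinity hQ).unique h.transcendental h.ne_zero h.isCoprime.neg_right
    h.exists_mul_eq_sum (h.isKummerOver_infinity hR)

theorem ord_sub_of_pos (h : IsKummerGenerator α x z m) {Q : Place k F} {μ : Fin (n + 1)}
    (hQ : 0 < Q.ord (x - algebraMap k F (α μ))) (ν : Fin (n + 1)) :
    Q.ord (x - algebraMap k F (α ν)) = if ν = μ then (m : ℤ) else 0 := by
  classical
  have h1 := (h.isKummerOver_finite hQ).ord_aeval (X - C (α ν)) (X_sub_C_ne_zero _)
  simp only [map_sub, aeval_X, aeval_C, one_mul] at h1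
  rw [h1, rootMultiplicity_X_sub_C]
  simp only [h.injective.eq_iff, eq_comm (a := μ)]
  split_ifs <;> simp

theorem ord_sub_of_neg (h : IsKummerGenerator α x z m) {Q : Place k F} (hQ : Q.ord x < 0)
    (c : k) : Q.ord (x - algebraMap k F c) = -m := by
  have h1 := (h.isKummerOver_infinity hQ).ord_aeval (X - C c) (X_sub_C_ne_zero _)
  simp only [map_sub, aeval_X, aeval_C, one_mul] at h1
  rw [h1, natDegree_X_sub_C]
  ring

theorem ord_monomial_finite_zero (h : IsKummerGenerator α x z m) {Q : Place k F}
    (hQ : 0 < Q.ord (x - algebraMap k F (α 0))) (w : ℤ × (Fin n → ℤ)) :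
    Q.ord (kummerMonomial α x z w) = w.1 := by
  rw [h.ord_monomial, (h.isKummerOver_finite hQ).ord_gen]
  simp only [h.ord_sub_of_pos hQ]
  simp [Fin.succ_ne_zero]

theorem ord_monomial_finite_succ (h : IsKummerGenerator α x z m) {Q : Place k F} {μ : Fin n}
    (hQ : 0 < Q.ord (x - algebraMap k F (α μ.succ))) (w : ℤ × (Fin n → ℤ)) :
    Q.ord (kummerMonomial α x z w) = w.1 + m * w.2 μ := by
  rw [h.ord_monomial, (h.isKummerOver_finite hQ).ord_gen]
  simp only [h.ord_sub_of_pos hQ]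
  simp [mul_comm]

theorem ord_monomial_infinity (h : IsKummerGenerator α x z m) {Q : Place k F} (hQ : Q.ord x < 0)
    (w : ℤ × (Fin n → ℤ)) :
    Q.ord (kummerMonomial α x z w) = -(((n + 1 : ℕ) : ℤ) * w.1 + m * ∑ μ, w.2 μ) := by
  rw [h.ord_monomial, (h.isKummerOver_infinity hQ).ord_gen]
  simp only [h.ord_sub_of_neg hQ, ← Finset.sum_mul]
  ring

/-- Outside the zeros of the `x - α_μ` and the pole of `x`, these elements and `z` are units. -/
theorem ord_eq_zero (h : IsKummerGenerator α x z m) {Q : Place k F}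
    (hQ : ∀ μ, ¬ 0 < Q.ord (x - algebraMap k F (α μ))) (hQ' : ¬ Q.ord x < 0) :
    Q.ord z = 0 ∧ ∀ μ, Q.ord (x - algebraMap k F (α μ)) = 0 := by
  have h1 : ∀ μ, Q.ord (x - algebraMap k F (α μ)) = 0 := fun μ => by
    refine le_antisymm (not_lt.1 (hQ μ)) (Q.val_le_one_iff.1 ?_)
    exact Q.val.map_sub_le (Q.val_le_one_iff.2 (not_lt.1 hQ')) (Q.val_algebraMap_le_one _)
  refine ⟨?_, h1⟩
  have h2 := h.ord_kummerF Q
  rw [kummerF, Q.ord_prod _ _ fun μ _ => h.sub_ne_zero (α μ)] at h2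
  simp only [h1, Finset.sum_const_zero] at h2
  have hm : (m : ℤ) ≠ 0 := by exact_mod_cast h.pos.ne'
  exact (mul_eq_zero.1 h2.symm).resolve_left hm

/-! ### The monomials of Ω span L(G) -/

variable {P : Fin (n + 1) → Place k F} {Pinf : Place k F}

theorem place_injective (h : IsKummerGenerator α x z m)
    (hP : ∀ μ, 0 < (P μ).ord (x - algebraMap k F (α μ))) : Function.Injective P := by
  intro μ ν hμν
  by_contra hne
  have h1 := h.ord_sub_of_pos (hP μ) ν
  rw [hμν, if_neg (Ne.symm hne)] at h1
  exact (hP ν).ne' h1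

theorem place_ne_infinity (h : IsKummerGenerator α x z m)
    (hP : ∀ μ, 0 < (P μ).ord (x - algebraMap k F (α μ))) (hPinf : Pinf.ord x < 0)
    (μ : Fin (n + 1)) : P μ ≠ Pinf := by
  intro h1
  have h2 := hP μ
  rw [h1, h.ord_sub_of_neg hPinf] at h2
  have := h.pos
  omega

theorem kummerDivisor_apply_place (h : IsKummerGenerator α x z m)
    (hP : ∀ μ, 0 < (P μ).ord (x - algebraMap k F (α μ))) (hPinf : Pinf.ord x < 0)
    (s : Fin (n + 1) → ℤ) (t : ℤ) (μ : Fin (n + 1)) : kummerDivisor P Pinf s t (P μ) = s μ := by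
  classical
  simp only [kummerDivisor, Finsupp.add_apply, Finsupp.finsetSum_apply, Finsupp.single_apply,
    (h.place_injective hP).eq_iff, (h.place_ne_infinity hP hPinf μ).symm]
  simp

theorem kummerDivisor_apply_infinity (h : IsKummerGenerator α x z m)
    (hP : ∀ μ, 0 < (P μ).ord (x - algebraMap k F (α μ))) (hPinf : Pinf.ord x < 0)
    (s : Fin (n + 1) → ℤ) (t : ℤ) : kummerDivisor P Pinf s t Pinf = t := by
  classical
  simp only [kummerDivisor, Finsupp.add_apply, Finsupp.finsetSum_apply, Finsupp.single_apply,
    (h.place_ne_infinity hP hPinf _)]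
  simp

theorem _root_.kummerDivisor_apply_of_ne (s : Fin (n + 1) → ℤ) (t : ℤ) {Q : Place k F}
    (hQ : ∀ μ, P μ ≠ Q) (hQ' : Pinf ≠ Q) : kummerDivisor P Pinf s t Q = 0 := by
  classical
  simp [kummerDivisor, hQ, hQ']

/-- Every place is a `P_μ`, or `P_∞`, or a place at which `z` and all `x - α_μ` are units. -/
theorem place_cases (h : IsKummerGenerator α x z m)
    (hP : ∀ μ, 0 < (P μ).ord (x - algebraMap k F (α μ))) (hPinf : Pinf.ord x < 0)
    (s : Fin (n + 1) → ℤ) (t : ℤ) (Q : Place k F) :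
    (∃ μ, Q = P μ) ∨ Q = Pinf ∨ (kummerDivisor P Pinf s t Q = 0 ∧ Q.ord z = 0 ∧
      ∀ μ, Q.ord (x - algebraMap k F (α μ)) = 0) := by
  by_cases h1 : ∃ μ, 0 < Q.ord (x - algebraMap k F (α μ))
  · obtain ⟨μ, hμ⟩ := h1
    exact Or.inl ⟨μ, h.eq_of_ord_sub_pos hμ (hP μ)⟩
  by_cases h2 : Q.ord x < 0
  · exact Or.inr (Or.inl (h.eq_of_ord_neg h2 hPinf))
  refine Or.inr (Or.inr ⟨?_, h.ord_eq_zero (not_exists.1 h1) h2⟩)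
  refine kummerDivisor_apply_of_ne s t (fun μ hμ => h1 ⟨μ, hμ ▸ hP μ⟩) fun hi => h2 (hi ▸ hPinf)

theorem monomial_mem (h : IsKummerGenerator α x z m)
    (hP : ∀ μ, 0 < (P μ).ord (x - algebraMap k F (α μ))) (hPinf : Pinf.ord x < 0)
    {s : Fin (n + 1) → ℤ} {t : ℤ} {w : ℤ × (Fin n → ℤ)} (hw : w ∈ latticeOmega m s t) :
    kummerMonomial α x z w ∈ riemannRochSpace (kummerDivisor P Pinf s t) := by
  refine Or.inr fun Q => ?_
  obtain ⟨hw0, hwμ, hwt⟩ := hw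
  rcases h.place_cases hP hPinf s t Q with ⟨μ, rfl⟩ | rfl | ⟨hD, hz, hα⟩
  · rw [h.kummerDivisor_apply_place hP hPinf]
    induction μ using Fin.cases with
    | zero => rwa [h.ord_monomial_finite_zero (hP 0)]
    | succ μ =>
      rw [h.ord_monomial_finite_succ (hP μ.succ)]
      exact (hwμ μ).1
  · rw [h.kummerDivisor_apply_infinity hP hPinf, h.ord_monomial_infinity hPinf]
    linarith
  · rw [hD, h.ord_monomial, hz]
    simp [hα]

/-- A term `p(x) z ^ i / f(x) ^ M` satisfying the order conditions of `L(G)` at the `P_μ` and at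
`P_∞` is a linear combination of monomials. -/
theorem term_mem_span (h : IsKummerGenerator α x z m) {s : Fin (n + 1) → ℤ} {t : ℤ} {p : k[X]}
    (hp : p ≠ 0) (i M : ℕ) (hM : ∀ μ, i + s μ ≤ m * M)
    (hfin : ∀ μ, 0 ≤ m * (p.rootMultiplicity (α μ) : ℤ) + i - m * M + s μ)
    (hinf : m * (p.natDegree : ℤ) + ((n + 1 : ℕ) : ℤ) * i - m * ((n + 1 : ℕ) : ℤ) * M ≤ t) :
    aeval x p * z ^ i / kummerF α x ^ M ∈
      Submodule.span k (kummerMonomial α x z '' latticeOmega m s t) := by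
  have hm : (0 : ℤ) < m := by exact_mod_cast h.pos
  -- The unique j_μ with 0 ≤ i + m j_μ + s_μ < m, that is, the least exponent of x - α_μ admissible
  -- at P_μ.
  set j : Fin (n + 1) → ℤ := fun μ => -((i + s μ) / m) with hj
  have hj0 : ∀ μ, 0 ≤ i + m * j μ + s μ := fun μ => by
    have := Int.emod_nonneg (i + s μ) hm.ne'
    rw [Int.emod_def] at this
    simp only [hj]
    linarith
  have hj1 : ∀ μ, i + m * j μ + s μ < m := fun μ => by
    have := Int.emod_lt_of_pos (i + s μ) hm
    rw [Int.emod_def] at this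
    simp only [hj]
    linarith
  have hjM : ∀ μ, 0 ≤ j μ + M := fun μ => by
    have : (i + s μ) / m ≤ M := Int.ediv_le_of_le_mul hm (by linarith [hM μ])
    simp only [hj]
    linarith
  obtain ⟨N, hN⟩ : ∃ N : Fin (n + 1) → ℕ, ∀ μ, j μ + M = N μ :=
    ⟨fun μ => (j μ + M).toNat, fun μ => (Int.toNat_of_nonneg (hjM μ)).symm⟩
  have hdvd : ∏ μ, (X - C (α μ)) ^ N μ ∣ p := by
    refine Finset.prod_dvd_of_coprime (fun μ _ ν _ hμν =>
      (pairwise_coprime_X_sub_C h.injective hμν).pow) fun μ _ => ?_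
    refine (le_rootMultiplicity_iff hp).1 ?_
    -- The order condition at P_μ together with i + m j_μ + s_μ < m bounds the multiplicity of α_μ
    -- from below by j_μ + M.
    have h1 : 0 < m * ((p.rootMultiplicity (α μ) : ℤ) - N μ + 1) := by
      rw [← hN μ]
      linarith [hfin μ, hj1 μ]
    have h2 := pos_of_mul_pos_right h1 hm.le
    omega
  obtain ⟨q, rfl⟩ := hdvd
  have hq : q ≠ 0 := right_ne_zero_of_mul hp
  have hdeg : (((∏ μ, (X - C (α μ)) ^ N μ) * q).natDegree : ℤ) =
      ∑ μ, (j μ + M) + q.natDegree := by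
    have hmon : ∀ μ ∈ (Finset.univ : Finset (Fin (n + 1))), ((X - C (α μ)) ^ N μ).Monic :=
      fun μ _ => (monic_X_sub_C _).pow _
    rw [(monic_prod_of_monic _ _ hmon).natDegree_mul' hq, natDegree_prod_of_monic _ _ hmon]
    simp [hN]
  -- Expanding the cofactor at α_1 leaves the exponents at the other α_μ untouched; only x - α_1
  -- gets an extra l, traded below for powers of z ^ m.
  have hsum : aeval x q = (taylor (α 0) q).sum
      fun l c => algebraMap k F c * (x - algebraMap k F (α 0)) ^ l := by
    conv_lhs => rw [← sum_taylor_eq q (α 0)]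
    simp [Polynomial.sum_def, map_sum]
  rw [map_mul, hsum, Polynomial.sum_def, Finset.mul_sum, Finset.sum_mul, Finset.sum_div]
  refine Submodule.sum_mem _ fun l hl => ?_
  have hl' : l ≤ q.natDegree := by
    simpa using le_natDegree_of_mem_supp l hl
  have hterm : aeval x (∏ μ, (X - C (α μ)) ^ N μ) * (algebraMap k F ((taylor (α 0) q).coeff l) *
      (x - algebraMap k F (α 0)) ^ l) * z ^ i / kummerF α x ^ M =
      (taylor (α 0) q).coeff l • kummerMonomial α x z
        (i + m * (j 0 + l), fun μ => j μ.succ - (j 0 + l)) := by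
    have h1 : aeval x (∏ μ, (X - C (α μ)) ^ N μ) =
        (∏ μ, (x - algebraMap k F (α μ)) ^ j μ) * kummerF α x ^ M := by
      rw [kummerF, ← Finset.prod_pow, ← Finset.prod_mul_distrib, map_prod]
      refine Finset.prod_congr rfl fun μ _ => ?_
      rw [map_pow, map_sub, aeval_X, aeval_C, ← zpow_natCast, ← zpow_natCast,
        ← hN μ, zpow_add₀ (h.sub_ne_zero _)]
    rw [h.monomial_add_mul i (j 0 + l) fun μ => j μ.succ, h1, Fin.prod_univ_succ,
      zpow_add₀ (h.sub_ne_zero _), zpow_natCast, zpow_natCast, Algebra.smul_def,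
      div_eq_iff (pow_ne_zero _ h.kummerF_ne_zero)]
    ring
  rw [hterm]
  refine Submodule.smul_mem _ _ (Submodule.subset_span ⟨_, ⟨?_, fun μ => ?_, ?_⟩, rfl⟩)
  · have : (0 : ℤ) ≤ m * l := by positivity
    have := hj0 0
    simp only
    linarith
  · have h0 := hj0 μ.succ
    have h1 := hj1 μ.succ
    simp only
    constructor <;> linarith
  · have h1 : (m : ℤ) * l ≤ m * q.natDegree := by
      exact_mod_cast Nat.mul_le_mul_left m hl'
    rw [hdeg, Fin.sum_univ_succ, Finset.sum_add_distrib] at hinf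
    simp only [Finset.sum_sub_distrib, Finset.sum_const, Finset.card_univ, Fintype.card_fin,
      nsmul_eq_mul] at hinf ⊢
    push_cast at hinf ⊢
    linarith

theorem mem_span_monomial (h : IsKummerGenerator α x z m)
    (hP : ∀ μ, 0 < (P μ).ord (x - algebraMap k F (α μ))) (hPinf : Pinf.ord x < 0)
    {s : Fin (n + 1) → ℤ} {t : ℤ} {g : F}
    (hg : g ∈ riemannRochSpace (kummerDivisor P Pinf s t)) :
    g ∈ Submodule.span k (kummerMonomial α x z '' latticeOmega m s t) := by
  rcases eq_or_ne g 0 with rfl | hg0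
  · exact Submodule.zero_mem _
  replace hg : ∀ Q : Place k F, 0 ≤ Q.ord g + kummerDivisor P Pinf s t Q := hg.resolve_left hg0
  have hm : (0 : ℤ) < m := by exact_mod_cast h.pos
  have hm1 : (1 : ℤ) ≤ m := hm
  have hgP : ∀ μ, 0 ≤ (P μ).ord g + s μ := fun μ => by
    simpa only [h.kummerDivisor_apply_place hP hPinf] using hg (P μ)
  have hgi : 0 ≤ Pinf.ord g + t := by
    simpa only [h.kummerDivisor_apply_infinity hP hPinf] using hg Pinf
  -- As f(x) has order m at each P_μ, the factor f ^ M removes all poles of g away from P_∞.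
  obtain ⟨M, hM⟩ : ∃ M : ℕ, ∀ μ, |s μ| ≤ M := by
    refine ⟨∑ μ, (s μ).natAbs, fun μ => ?_⟩
    rw [Int.abs_eq_natAbs]
    exact_mod_cast Finset.single_le_sum (f := fun μ => (s μ).natAbs) (fun _ _ => Nat.zero_le _)
      (Finset.mem_univ μ)
  have hmM : ∀ μ, |s μ| ≤ m * M := fun μ =>
    (hM μ).trans (le_mul_of_one_le_left (Nat.cast_nonneg M) hm1)
  have hf0 := h.kummerF_ne_zero
  have hreg : ∀ Q : Place k F, Q.val x ≤ 1 → Q.val (kummerF α x ^ M * g) ≤ 1 := by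
    intro Q hQ
    rw [Q.val_le_one_iff, Q.ord_mul (pow_ne_zero _ hf0) hg0, Q.ord_pow, h.ord_kummerF]
    rcases h.place_cases hP hPinf s t Q with ⟨μ, rfl⟩ | rfl | ⟨hD, hz, -⟩
    · rw [(h.isKummerOver_finite (hP μ)).ord_gen]
      linarith [hgP μ, hmM μ, le_abs_self (s μ)]
    · exact absurd (Q.val_le_one_iff.1 hQ) (not_le.2 hPinf)
    · have := hg Q
      rw [hD] at this
      rw [hz]
      linarith
  have hover := h.isKummerOver_infinity hPinf
  obtain ⟨p, hp⟩ := exists_mul_eq_sum_of_forall_place h.transcendental h.natCast_ne_zero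
    (monic_kummerPoly α).ne_zero h.pow_eq_aeval h.adjoin_eq_top
    (fun p hp => hover.sum_ne_zero h.transcendental h.ne_zero h.isCoprime.neg_right hp) hreg
  rw [aeval_kummerPoly, ← mul_assoc, ← pow_succ'] at hp
  have hp0 : p ≠ 0 := by
    rintro rfl
    simp [hf0, hg0] at hp
  have hgsum : g = ∑ i : Fin m, aeval x (p i) * z ^ (i : ℕ) / kummerF α x ^ (M + 1) := by
    rw [← Finset.sum_div, ← hp, mul_div_cancel_left₀ _ (pow_ne_zero _ hf0)]
  have hordg : ∀ Q : Place k F,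
      Q.ord (∑ i : Fin m, aeval x (p i) * z ^ (i : ℕ)) = (M + 1) * (m * Q.ord z) + Q.ord g := by
    intro Q
    rw [← hp, Q.ord_mul (pow_ne_zero _ hf0) hg0, Q.ord_pow, h.ord_kummerF]
    push_cast
    ring
  rw [hgsum]
  refine Submodule.sum_mem _ fun i _ => ?_
  rcases eq_or_ne (p i) 0 with hpi | hpi
  · simp [hpi]
  refine h.term_mem_span hpi _ _ (fun μ => ?_) (fun μ => ?_) ?_
  -- The exponent is M + 1, and the additional factor f ^ 1 absorbs i < m.
  · have h1 : (i : ℤ) < m := by exact_mod_cast i.2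
    push_cast
    linarith [hmM μ, le_abs_self (s μ)]
  -- Without cancellation the order of the whole sum is the minimum over its nonzero terms, so the
  -- bound for g passes to the i-th term; likewise at P_∞ below.
  · have hk := h.isKummerOver_finite (hP μ)
    obtain ⟨i₀, hi₀, hmin⟩ := Place.exists_min_order p hp0
      (fun p => (p.rootMultiplicity (α μ) : ℤ)) 1
    have h1 := (hk.ord_sum h.transcendental h.ne_zero isCoprime_one_right p hi₀ hmin).2
    rw [hordg, hk.ord_gen] at h1
    have h2 := hmin i hpi
    have h3 := hgP μ
    push_cast
    linarith
  · obtain ⟨i₀, hi₀, hmin⟩ := Place.exists_min_order p hp0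
      (fun p => -(p.natDegree : ℤ)) (-((n + 1 : ℕ) : ℤ))
    have h1 := (hover.ord_sum h.transcendental h.ne_zero h.isCoprime.neg_right p hi₀ hmin).2
    rw [hordg, hover.ord_gen] at h1
    have h2 := hmin i hpi
    push_cast at *
    linarith

theorem span_monomial (h : IsKummerGenerator α x z m)
    (hP : ∀ μ, 0 < (P μ).ord (x - algebraMap k F (α μ))) (hPinf : Pinf.ord x < 0)
    (s : Fin (n + 1) → ℤ) (t : ℤ) :
    Submodule.span k (kummerMonomial α x z '' latticeOmega m s t) =
      riemannRochSpace (kummerDivisor P Pinf s t) := by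
  refine le_antisymm (Submodule.span_le.2 ?_) fun g hg => h.mem_span_monomial hP hPinf hg
  rintro _ ⟨w, hw, rfl⟩
  exact h.monomial_mem hP hPinf hw

end IsKummerGenerator

end KummerMonomial

/-! ### The lattice point sets Θ and Ω -/

section LatticePoints

variable {n : ℕ}

/-- The linear bijection of `ℤ ^ r` carrying `Θ` to `Ω`. -/
def latticeEquiv (m : ℕ) (a b : ℤ) (hab : a * ((n + 1 : ℕ) : ℤ) + b * m = 1) :
    ℤ × (Fin n → ℤ) ≃ ℤ × (Fin n → ℤ) where
  -- In Λ_{u,v} the exponent of z is -a u and that of x - α_1 is c = -(b u + ∑ v_μ); eliminating x -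
  -- α_1 by z ^ m = f(x) adds m c to the former and subtracts c from each v_μ.
  toFun w := (-a * w.1 + m * -(b * w.1 + ∑ μ, w.2 μ), fun μ => w.2 μ - -(b * w.1 + ∑ μ, w.2 μ))
  invFun w := (-(((n + 1 : ℕ) : ℤ) * w.1 + m * ∑ μ, w.2 μ),
    fun μ => w.2 μ - (a * ∑ μ, w.2 μ - b * w.1))
  left_inv w := by
    push_cast at hab
    refine Prod.ext ?_ (funext fun μ => ?_)
    · simp only [Finset.sum_sub_distrib, Finset.sum_const, Finset.card_univ, Fintype.card_fin,
        nsmul_eq_mul]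
      push_cast
      linear_combination w.1 * hab
    · simp only [Finset.sum_sub_distrib, Finset.sum_const, Finset.card_univ, Fintype.card_fin,
        nsmul_eq_mul]
      linear_combination (-(b * w.1 + ∑ μ, w.2 μ)) * hab
  right_inv w := by
    push_cast at hab
    refine Prod.ext ?_ (funext fun μ => ?_)
    · simp only [Finset.sum_sub_distrib, Finset.sum_const, Finset.card_univ, Fintype.card_fin,
        nsmul_eq_mul]
      push_cast
      linear_combination (w.1 + m * ∑ μ, w.2 μ) * hab
    · simp only [Finset.sum_sub_distrib, Finset.sum_const, Finset.card_univ, Fintype.card_fin,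
        nsmul_eq_mul]
      push_cast
      linear_combination (-∑ μ, w.2 μ) * hab

variable {m : ℕ} {a b : ℤ}

/-- In terms of functions: Λ_{u,v} has order u at P_∞. -/
theorem infinity_latticeEquiv (hab : a * ((n + 1 : ℕ) : ℤ) + b * m = 1) (w : ℤ × (Fin n → ℤ)) :
    ((n + 1 : ℕ) : ℤ) * (latticeEquiv m a b hab w).1 + m * ∑ μ, (latticeEquiv m a b hab w).2 μ =
      -w.1 := by
  have h := congrArg Prod.fst ((latticeEquiv m a b hab).symm_apply_apply w)
  change -(((n + 1 : ℕ) : ℤ) * (latticeEquiv m a b hab w).1 +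
    m * ∑ μ, (latticeEquiv m a b hab w).2 μ) = w.1 at h
  rw [← h, neg_neg]

theorem latticeEquiv_mem_iff (hab : a * ((n + 1 : ℕ) : ℤ) + b * m = 1) (s : Fin (n + 1) → ℤ)
    (t : ℤ) (w : ℤ × (Fin n → ℤ)) :
    latticeEquiv m a b hab w ∈ latticeOmega m s t ↔ w ∈ latticeTheta m a b s t := by
  have h0 : (latticeEquiv m a b hab w).1 = -(a + b * m) * w.1 - m * ∑ μ, w.2 μ := by
    change -a * w.1 + m * -(b * w.1 + ∑ μ, w.2 μ) = _
    ring
  have h1 : ∀ μ, (latticeEquiv m a b hab w).1 + m * (latticeEquiv m a b hab w).2 μ =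
      -a * w.1 + m * w.2 μ := fun μ => by
    change -a * w.1 + m * -(b * w.1 + ∑ μ, w.2 μ) + m * (w.2 μ - -(b * w.1 + ∑ μ, w.2 μ)) = _
    ring
  rw [latticeOmega, latticeTheta, Set.mem_ofPred_eq, Set.mem_ofPred_eq, infinity_latticeEquiv hab,
    h0]
  rw [h0] at h1
  simp only [h1, neg_le (a := w.1)]

theorem image_latticeTheta (hab : a * ((n + 1 : ℕ) : ℤ) + b * m = 1) (s : Fin (n + 1) → ℤ)
    (t : ℤ) : latticeEquiv m a b hab '' latticeTheta m a b s t = latticeOmega m s t := by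
  ext w
  rw [Equiv.image_eq_preimage_symm, Set.mem_preimage, ← latticeEquiv_mem_iff hab,
    Equiv.apply_symm_apply]

/-- A point of `Θ` is determined by its coordinate `u`. -/
theorem injOn_fst_latticeTheta (hm : 0 < m) (s : Fin (n + 1) → ℤ) (t : ℤ) :
    Set.InjOn Prod.fst (latticeTheta m a b s t) := by
  rintro ⟨u, v⟩ ⟨-, hv, -⟩ ⟨u', v'⟩ ⟨-, hv', -⟩ rfl
  refine Prod.ext rfl (funext fun μ => ?_)
  have h1 := hv μ
  have h2 := hv' μ
  simp only at h1 h2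
  have h3 := Int.eq_zero_of_abs_lt_dvd (m := m) (x := m * (v μ - v' μ)) ⟨_, rfl⟩
    (by rw [abs_lt]; constructor <;> linarith)
  have h4 : (m : ℤ) ≠ 0 := by exact_mod_cast hm.ne'
  exact sub_eq_zero.1 ((mul_eq_zero.1 h3).resolve_left h4)

/-- Adding the lower bounds at all P_μ cancels the v_μ and leaves u ≤ ∑ s_μ, because a r + b m = 1;
this reflects that a principal divisor has degree 0. So u ranges over a finite interval, and u
determines the point. -/
theorem finite_latticeTheta (hm : 0 < m) (hab : a * ((n + 1 : ℕ) : ℤ) + b * m = 1)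
    (s : Fin (n + 1) → ℤ) (t : ℤ) : (latticeTheta m a b s t).Finite := by
  refine Set.Finite.of_finite_image ((Set.finite_Icc (-t) (∑ μ, s μ)).subset ?_)
    (injOn_fst_latticeTheta hm s t)
  rintro _ ⟨⟨u, v⟩, ⟨h0, hv, ht⟩, rfl⟩
  refine ⟨ht, ?_⟩
  have h1 : 0 ≤ ∑ μ : Fin n, (-a * u + m * v μ + s μ.succ) :=
    Finset.sum_nonneg fun μ _ => (hv μ).1
  simp only [Finset.sum_add_distrib, Finset.sum_const, Finset.card_univ, Fintype.card_fin,
    nsmul_eq_mul, ← Finset.mul_sum] at h1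
  rw [Fin.sum_univ_succ]
  have h2 : u = u * (a * ((n + 1 : ℕ) : ℤ) + b * m) := by rw [hab, mul_one]
  simp only at h0 ⊢
  push_cast at h2
  linarith

end LatticePoints

/-! ### The basis Λ of L(G) -/

section KummerBasis

variable {k F : Type*} [Field k] [Field F] [Algebra k F] {n : ℕ}

/-- Elements with pairwise distinct orders at a place are linearly independent over `k`. -/
theorem Place.linearIndependent_of_injective_ord (Q : Place k F) {ι : Type*} {f : ι → F}
    (hf : ∀ i, f i ≠ 0) (hinj : Function.Injective fun i => Q.ord (f i)) :
    LinearIndependent k f := by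
  classical
  rw [linearIndependent_iff']
  intro S c hsum i hi
  by_contra hci
  obtain ⟨i₀, hi₀, hmin⟩ := Finset.exists_min_image (S.filter fun i => c i ≠ 0)
    (fun i => Q.ord (c i • f i)) ⟨i, by simp [hi, hci]⟩
  have hord : ∀ i, c i ≠ 0 → Q.ord (c i • f i) = Q.ord (f i) := fun i hci => by
    rw [Algebra.smul_def, Q.ord_mul (by simpa using hci) (hf i), Q.ord_algebraMap, zero_add]
  refine (Q.ord_sum_of_injOn (S.filter fun i => c i ≠ 0) (fun i => c i • f i) (fun i hi => ?_)
    (fun i hi j hj hij => ?_) hi₀ hmin).1 ?_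
  · exact smul_ne_zero (Finset.mem_filter.1 hi).2 (hf i)
  · simp only [hord i (Finset.mem_filter.1 hi).2, hord j (Finset.mem_filter.1 hj).2] at hij
    exact hinj hij
  · rw [← hsum, Finset.sum_filter]
    refine Finset.sum_congr rfl fun i _ => ?_
    split_ifs with hi
    · rfl
    · rw [not_not.1 hi, zero_smul]

variable {α : Fin (n + 1) → k} {x y : F} {m : ℕ} {A B a b lam : ℤ}

theorem IsKummerGenerator.kummerLambda_eq
    (h : IsKummerGenerator α x (kummerZ α x y A B) m)
    (hab : a * ((n + 1 : ℕ) : ℤ) + b * m = 1) (w : ℤ × (Fin n → ℤ)) :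
    kummerLambda α x y A B a b w =
      kummerMonomial α x (kummerZ α x y A B) (latticeEquiv m a b hab w) := by
  have hx := h.sub_ne_zero (α 0)
  change _ = kummerMonomial α x (kummerZ α x y A B) (-a * w.1 + m * -(b * w.1 + ∑ μ, w.2 μ),
    fun μ => w.2 μ - -(b * w.1 + ∑ μ, w.2 μ))
  rw [h.monomial_add_mul, kummerLambda, kummerBeta, mul_zpow, ← zpow_mul, ← zpow_mul]
  have h1 : ∏ μ : Fin n, kummerH α x μ.succ ^ w.2 μ =
      (∏ μ : Fin n, (x - algebraMap k F (α μ.succ)) ^ w.2 μ) *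
        (x - algebraMap k F (α 0)) ^ (-∑ μ, w.2 μ) := by
    have h2 : ∀ S : Finset (Fin n), ∏ μ ∈ S, (x - algebraMap k F (α 0)) ^ w.2 μ =
        (x - algebraMap k F (α 0)) ^ ∑ μ ∈ S, w.2 μ := fun S => by
      induction S using Finset.induction_on with
      | empty => simp
      | insert i S hi ih => rw [Finset.prod_insert hi, Finset.sum_insert hi, zpow_add₀ hx, ih]
    simp only [kummerH, div_zpow, Finset.prod_div_distrib, h2]
    rw [zpow_neg, div_eq_mul_inv]
  have h3 : -(b * w.1 + ∑ μ, w.2 μ) = -b * w.1 + -∑ μ, w.2 μ := by ring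
  rw [h1, h3, zpow_add₀ hx]
  ring

/-- The generator `z = y ^ A f(x) ^ B` of `k(x, y)`, where `y ^ m = f(x) ^ lam`, satisfies
`z ^ m = f(x)`. -/
theorem isKummerGenerator_kummerZ (hα : Function.Injective α) (hx : Transcendental k x)
    (hmk : (m : k) ≠ 0) (hm : 0 < m) (hcop : IsCoprime (m : ℤ) ((n + 1 : ℕ) : ℤ))
    (hxy : y ^ m = ∏ i, (x - algebraMap k F (α i)) ^ lam)
    (hF : IntermediateField.adjoin k {x, y} = ⊤) (hAB : A * lam + B * m = 1) :
    IsKummerGenerator α x (kummerZ α x y A B) m := by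
  have hf : kummerF α x ≠ 0 := by
    rw [← aeval_kummerPoly]
    exact fun h0 => hx ⟨_, (monic_kummerPoly α).ne_zero, h0⟩
  rw [Finset.prod_zpow] at hxy
  change y ^ m = kummerF α x ^ lam at hxy
  have hy : y ≠ 0 := by
    rintro rfl
    rw [zero_pow hm.ne'] at hxy
    exact zpow_ne_zero _ hf hxy.symm
  have hxy' : y ^ (m : ℤ) = kummerF α x ^ lam := by rw [zpow_natCast, hxy]
  -- With λ for `lam`: z ^ λ = y ^ (A λ) f ^ (λ B) = y ^ (A λ + B m) = y, so y lies in k(x, z).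
  have hyz : kummerZ α x y A B ^ lam = y := by
    rw [kummerZ, mul_zpow, ← zpow_mul, ← zpow_mul, mul_comm B, zpow_mul _ lam, ← hxy', ← zpow_mul,
      ← zpow_add₀ hy, mul_comm (m : ℤ), hAB, zpow_one]
  refine ⟨hα, hx, hmk, hcop, ?_, ?_⟩
  · rw [← zpow_natCast, kummerZ, mul_zpow, ← zpow_mul, ← zpow_mul, mul_comm A, zpow_mul _ (m : ℤ),
      hxy', ← zpow_mul, ← zpow_add₀ hf, mul_comm lam, hAB, zpow_one]
  · rw [eq_top_iff, ← hF, IntermediateField.adjoin_le_iff]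
    rintro g (rfl | hg)
    · exact IntermediateField.subset_adjoin _ _ (Set.mem_insert _ _)
    · have h1 : kummerZ α x y A B ∈ IntermediateField.adjoin k {x, kummerZ α x y A B} :=
        IntermediateField.subset_adjoin _ _ (Set.mem_insert_of_mem _ rfl)
      have h2 := zpow_mem h1 lam
      rw [hyz] at h2
      rwa [Set.mem_singleton_iff.1 hg]

/-- Independence is seen at P_∞, where the orders u are pairwise distinct on Θ; spanning is
transported from the monomials of Ω. -/
theorem IsKummerGenerator.exists_basis (h : IsKummerGenerator α x (kummerZ α x y A B) m)
    {P : Fin (n + 1) → Place k F} {Pinf : Place k F}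
    (hP : ∀ μ, 0 < (P μ).ord (x - algebraMap k F (α μ))) (hPinf : Pinf.ord x < 0)
    (hab : a * ((n + 1 : ℕ) : ℤ) + b * m = 1) (s : Fin (n + 1) → ℤ) (t : ℤ) :
    ∃ e : Module.Basis (latticeTheta m a b s t) k (riemannRochSpace (kummerDivisor P Pinf s t)),
      ∀ w, (e w : F) = kummerLambda α x y A B a b w := by
  have hLI : LinearIndependent k
      fun w : latticeTheta m a b s t => kummerLambda α x y A B a b w := by
    refine Pinf.linearIndependent_of_injective_ord (fun w => ?_) fun w w' hw => ?_
    · rw [h.kummerLambda_eq hab]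
      exact h.monomial_ne_zero _
    · simp only [h.kummerLambda_eq hab, h.ord_monomial_infinity hPinf, infinity_latticeEquiv,
        neg_neg] at hw
      exact Subtype.ext (injOn_fst_latticeTheta h.pos s t w.2 w'.2 hw)
  have hspan : Submodule.span k
      (Set.range fun w : latticeTheta m a b s t => kummerLambda α x y A B a b w) =
        riemannRochSpace (kummerDivisor P Pinf s t) := by
    rw [← h.span_monomial hP hPinf, ← image_latticeTheta hab, Set.image_image, Set.image_eq_range]
    simp only [h.kummerLambda_eq hab]
  refine ⟨(Module.Basis.span hLI).map (LinearEquiv.ofEq _ _ hspan), fun w => ?_⟩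
  rw [Module.Basis.map_apply, LinearEquiv.coe_ofEq_apply, Module.Basis.span_apply]

end KummerBasis

end

theorem corollary3p7
    {k F : Type*} [Field k] [Finite k] [Field F] [Algebra k F]
    (p : ℕ) [CharP k p]
    (m n : ℕ) (hm : 2 ≤ m) (hpm : Nat.Coprime p m)
    (lam : ℤ) (hgcd : Int.gcd (m : ℤ) (((n + 1 : ℕ) : ℤ) * lam) = 1)
    (α : Fin (n + 1) → k) (hα : Function.Injective α)
    -- the Kummer extension `F = k(x, y)` of the rational function field `k(x)`
    (x y : F) (hx : Transcendental k x)
    (hxy : y ^ m = ∏ i, (x - algebraMap k F (α i)) ^ lam)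
    (hF : IntermediateField.adjoin k {x, y} = ⊤)
    -- the places at the zeros of `x - α_μ` and at the pole of `x`
    (P : Fin (n + 1) → Place k F) (hP : ∀ μ, 0 < (P μ).ord (x - algebraMap k F (α μ)))
    (Pinf : Place k F) (hPinf : Pinf.ord x < 0)
    (A B : ℤ) (hAB : A * lam + B * m = 1)
    (a b : ℤ) (hab : a * ((n + 1 : ℕ) : ℤ) + b * m = 1)
    (s : Fin (n + 1) → ℤ) (t : ℤ) :
    (∃ e : Module.Basis (latticeTheta m a b s t) k (riemannRochSpace (kummerDivisor P Pinf s t)),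
      ∀ w, (e w : F) = kummerLambda α x y A B a b w) ∧
    (latticeTheta m a b s t).Finite ∧ (latticeOmega m s t).Finite ∧
    (latticeTheta m a b s t).ncard = (latticeOmega m s t).ncard := by
  have hm0 : 0 < m := by omega
  have hmk : (m : k) ≠ 0 := by
    rw [Ne, CharP.cast_eq_zero_iff k p]
    intro hdvd
    have hp1 : p = 1 := hpm.eq_one_of_dvd hdvd
    exact CharP.char_ne_one k p hp1
  have hcop : IsCoprime (m : ℤ) ((n + 1 : ℕ) : ℤ) :=
    IsCoprime.of_mul_right_left (Int.isCoprime_iff_gcd_eq_one.2 hgcd)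
  have hfin := finite_latticeTheta hm0 hab s t
  refine ⟨(isKummerGenerator_kummerZ hα hx hmk hm0 hcop hxy hF hAB).exists_basis hP hPinf hab s t,
    hfin, ?_, ?_⟩
  · rw [← image_latticeTheta hab]
    exact hfin.image _
  · rw [← image_latticeTheta hab, Set.ncard_image_of_injective _ (Equiv.injective _)]
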